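/- Let $X$ be the Cantor set, let $U,V\subset X$ be open sets such that $X_U:=X\setminus U$ and $X_V:=X\setminus V$ are nonempty, finite and disjoint, and let $h:U\to V$ be a homeomorphism that is minimal, i.e. for every $x\in X$ the orbit $\{h^n(x) : n\in\mathbb Z,\ h^n(x)\text{ is defined}\}$ is dense in $X$. A *Kakutani–Rokhlin partition* for $(X,h)$ is a partition $\{E(k,j): 1\le k\le K,\ 1\le j\le J(k)\}$ of $X$ into nonempty clopen sets (with $K, J(k)\ge 1$) such that 1. $X_U\subset\bigcup_k E(k,J(k))$ and $X_V\subset\bigcup_k E(k,1)$; 2. $h(E(k,j))=E(k,j+1)$ for $1\le k\le K$ and $1\le j<J(k)$; 3. $\bigcup_k h(E(k,J(k))\setminus X_U)\cup X_V=\bigcup_k E(k,1)$. Consider sequences $\{\mathcal P_n\}_{n\ge 0}$ of Kakutani–Rokhlin partitions $\mathcal P_n=\{E(n,k,j): 1\le k\le K_n,\ 1\le j\le J(n,k)\}$ such that (a) the sets $\bigcup_k E(n,k,1)$, $n\ge 0$, are decreasing with intersection $X_V$; (b) $\mathcal P_{n+1}$ is finer than $\mathcal P_n$ for all $n$; (c)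 $\bigcup_n\mathcal P_n$ generates the topology of $X$. The *ordered Bratteli diagram constructed from* $\{\mathcal P_n\}$ is defined as follows, where $\mathcal P_0$ is replaced by the trivial partition $\{X\}$: $K_0=1$, $J(0,1)=1$, $E(0,1,1)=X$. The vertices at level $n\ge 0$ are $(n,1),\dots,(n,K_n)$. The edges from level $n-1$ to level $n$ ($n\ge 1$) are the quadruples $(n,m,k,j')$ with $1\le m\le K_{n-1}$, $1\le k\le K_n$, $0\le j'\le J(n,k)-J(n-1,m)$ and $E(n,k,j'+j)\subset E(n-1,m,j)$ for all $1\le j\le J(n-1,m)$; such an edge has source $(n-1,m)$ and range $(n,k)$. Two edges are comparable if and only if they have the same range, and edges with the same range are ordered by their last coordinate $j'$. An *isomorphism* of ordered Bratteli diagrams is a pair of bijections between the vertex sets and between the edge sets that preserve the gradings, intertwine the range and source maps, and preserve the order in both directions. For a strictly increasing sequence $0=m_0<m_1<m_2<\cdots$ of integers, the *contraction* of an ordered Bratteli diagram to $(m_n)_{n\ge0}$ has as vertices at level $n$ those of level $m_n$, and as edges from level $n-1$ to level $n$ the paths from level $m_{n-1}$ to level $m_n$, with the induced source and range. Paths with the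 same range are ordered lexicographically starting from the range: of two distinct such paths, the smaller is the one whose edge is smaller at the last level at which they differ. Two ordered Bratteli diagrams are *equivalent* if they are related by the equivalence relation generated by isomorphism and contraction. **Theorem.** If $\{\mathcal P_n\}_{n\ge0}$ and $\{\mathcal Q_n\}_{n\ge0}$ are two sequences of Kakutani–Rokhlin partitions for $(X,h)$ satisfying (a)–(c), then the ordered Bratteli diagrams constructed from $\{\mathcal P_n\}_{n\ge0}$ and $\{\mathcal Q_n\}_{n\ge0}$ are equivalent. -/

import Mathlib

open Set

/-! ### Ordered Bratteli diagrams -/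

/-- An ordered Bratteli diagram. The vertex set is the disjoint union of the finite nonempty sets
`V n`, `n ≥ 0`; `E n` is the set of edges from level `n` to level `n + 1`. A pair of edges is
comparable exactly when the two edges have the same range (edges at different levels have
different ranges, so it is enough to give an order on each `E n`). -/
structure OrderedBratteliDiagram where
  V : ℕ → Type
  E : ℕ → Type
  V_finite : ∀ n, Finite (V n)
  E_finite : ∀ n, Finite (E n)
  V_nonempty : ∀ n, Nonempty (V n)
  root_unique : ∀ v w : V 0, v = w
  s : ∀ n, E n → V n
  r : ∀ n, E n → V (n + 1)
  s_surjective : ∀ n, Function.Surjective (s n)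
  r_surjective : ∀ n, Function.Surjective (r n)
  ord : ∀ n, PartialOrder (E n)
  comparable_iff : ∀ n (e f : E n), (e ≤ f ∨ f ≤ e) ↔ r n e = r n f

namespace OrderedBratteliDiagram

attribute [instance] OrderedBratteliDiagram.ord

/-- A finite path from level `k` to level `l`, given by its vertices at the levels `k, …, l` and
its edges from level `i` to level `i + 1` for `k ≤ i < l`. -/
@[ext]
structure Path (B : OrderedBratteliDiagram) (k l : ℕ) where
  vtx : ∀ i, k ≤ i → i ≤ l → B.V i
  edge : ∀ i, k ≤ i → i < l → B.E i
  src : ∀ i (hk : k ≤ i) (hl : i < l), B.s i (edge i hk hl) = vtx i hk hl.le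
  rng : ∀ i (hk : k ≤ i) (hl : i < l),
    B.r i (edge i hk hl) = vtx (i + 1) (Nat.le_succ_of_le hk) hl

namespace Path

variable {B : OrderedBratteliDiagram} {k l : ℕ}

/-- `p` precedes `q`: reading the paths backwards from their last edge, at the first level where
they differ the edge of `p` is smaller than the edge of `q`. -/
def Lt (p q : B.Path k l) : Prop :=
  ∃ i, ∃ (hk : k ≤ i) (hl : i < l), p.edge i hk hl < q.edge i hk hl ∧
    ∀ j (hj : i < j) (hjl : j < l),
      p.edge j (hk.trans hj.le) hjl = q.edge j (hk.trans hj.le) hjl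

theorem ext_edge (hkl : k < l) {p q : B.Path k l}
    (h : ∀ i (hk : k ≤ i) (hl : i < l), p.edge i hk hl = q.edge i hk hl) : p = q := by
  ext i hk hl
  · rcases hl.lt_or_eq with hl' | rfl
    · rw [← p.src i hk hl', ← q.src i hk hl', h]
    · obtain ⟨j, rfl⟩ : ∃ j, i = j + 1 := ⟨i - 1, by omega⟩
      rw [← p.rng j (by omega) (by omega), ← q.rng j (by omega) (by omega), h]
  · exact h i hk hl

theorem Lt.irrefl (p : B.Path k l) : ¬ p.Lt p := by
  rintro ⟨i, hk, hl, h, -⟩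
  exact lt_irrefl _ h

theorem Lt.trans {p q t : B.Path k l} (h : p.Lt q) (h' : q.Lt t) : p.Lt t := by
  obtain ⟨i, hk, hl, h1, h2⟩ := h
  obtain ⟨i', hk', hl', h1', h2'⟩ := h'
  rcases lt_trichotomy i i' with hi | rfl | hi
  · exact ⟨i', hk', hl', (h2 i' hi hl') ▸ h1', fun j hj hjl =>
      (h2 j (hi.trans hj) hjl).trans (h2' j hj hjl)⟩
  · exact ⟨i, hk, hl, h1.trans h1', fun j hj hjl => (h2 j hj hjl).trans (h2' j hj hjl)⟩
  · exact ⟨i, hk, hl, (h2' i hi hl) ▸ h1, fun j hj hjl =>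
      (h2 j hj hjl).trans (h2' j (hi.trans hj) hjl)⟩

/-- The (backwards) lexicographic order on the paths from level `k` to level `l`. -/
instance : PartialOrder (B.Path k l) where
  le p q := p = q ∨ p.Lt q
  le_refl p := Or.inl rfl
  le_trans p q t := by
    rintro (rfl | h) (rfl | h')
    · exact Or.inl rfl
    · exact Or.inr h'
    · exact Or.inr h
    · exact Or.inr (h.trans h')
  le_antisymm p q := by
    rintro (rfl | h) (h' | h')
    · rfl
    · rfl
    · exact h'.symm
    · exact absurd (h.trans h') (Lt.irrefl p)

theorem le_def (p q : B.Path k l) : p ≤ q ↔ p = q ∨ p.Lt q := Iff.rfl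

theorem Lt.range_eq {p q : B.Path k l} (hkl : k < l) (h : p.Lt q) :
    p.vtx l hkl.le le_rfl = q.vtx l hkl.le le_rfl := by
  obtain ⟨i, hk, hl, h1, h2⟩ := h
  obtain ⟨j, rfl⟩ : ∃ j, l = j + 1 := ⟨l - 1, by omega⟩
  rw [← p.rng j (by omega) (by omega), ← q.rng j (by omega) (by omega)]
  rcases (Nat.lt_succ_iff.mp hl).lt_or_eq with hi | rfl
  · rw [h2 j hi (by omega)]
  · exact (B.comparable_iff i _ _).1 (Or.inl h1.le)

theorem comparable (hkl : k < l) (p q : B.Path k l) :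
    (p ≤ q ∨ q ≤ p) ↔ p.vtx l hkl.le le_rfl = q.vtx l hkl.le le_rfl := by
  classical
  constructor
  · rintro ((rfl | h) | (rfl | h))
    · rfl
    · exact h.range_eq hkl
    · rfl
    · exact (h.range_eq hkl).symm
  · intro h
    by_cases hpq : p = q
    · exact Or.inl (Or.inl hpq)
    let D : ℕ → Prop := fun i => ∃ (hk : k ≤ i) (hl : i < l), p.edge i hk hl ≠ q.edge i hk hl
    have hD : ∃ i ≤ l, D i := by
      by_contra hcon
      refine hpq (ext_edge hkl fun i hk hl => ?_)
      by_contra hne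
      exact hcon ⟨i, hl.le, hk, hl, hne⟩
    obtain ⟨i0, hi0, hDi0⟩ := hD
    have hDm : D (Nat.findGreatest D l) := Nat.findGreatest_spec hi0 hDi0
    have hmax : ∀ j, Nat.findGreatest D l < j → j ≤ l → ¬ D j :=
      fun j hj hjl => Nat.findGreatest_is_greatest hj hjl
    generalize Nat.findGreatest D l = i at hDm hmax
    obtain ⟨hk, hl, hne⟩ := hDm
    have hagree : ∀ j (hj : i < j) (hjl : j < l),
        p.edge j (hk.trans hj.le) hjl = q.edge j (hk.trans hj.le) hjl := by
      intro j hj hjl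
      by_contra hne'
      exact hmax j hj hjl.le ⟨_, hjl, hne'⟩
    have hr : B.r i (p.edge i hk hl) = B.r i (q.edge i hk hl) := by
      rw [p.rng, q.rng]
      rcases (Nat.succ_le_of_lt hl).lt_or_eq with hl' | rfl
      · rw [← p.src (i + 1) (by omega) hl', ← q.src (i + 1) (by omega) hl',
          hagree (i + 1) (by omega) hl']
      · exact h
    rcases (B.comparable_iff i _ _).2 hr with hle | hle
    · exact Or.inl (Or.inr ⟨i, hk, hl, lt_of_le_of_ne hle hne, hagree⟩)
    · exact Or.inr (Or.inr ⟨i, hk, hl, lt_of_le_of_ne hle hne.symm,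
        fun j hj hjl => (hagree j hj hjl).symm⟩)

theorem finite (hkl : k < l) : Finite (B.Path k l) := by
  have := B.E_finite
  let f : B.Path k l → (∀ i : Fin l, k ≤ (i : ℕ) → B.E i) := fun p i hk => p.edge i hk i.2
  refine Finite.of_injective f fun p q h => ext_edge hkl fun i hk hl => ?_
  exact congrFun (congrFun h ⟨i, hl⟩) hk

theorem exists_from (hkl : k ≤ l) (v : B.V k) : ∃ p : B.Path k l, p.vtx k le_rfl hkl = v := by
  choose f hf using fun i => B.s_surjective i
  exact ⟨{ vtx := fun i hk _ => Nat.leRecOn (C := B.V) hk (fun {j} w => B.r j (f j w)) v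
           edge := fun i hk _ => f i (Nat.leRecOn (C := B.V) hk (fun {j} w => B.r j (f j w)) v)
           src := fun i hk hl => hf i _
           rng := fun i hk hl => (Nat.leRecOn_succ (C := B.V) (next := fun {j} w => B.r j (f j w))
            hk v).symm }, Nat.leRecOn_self v⟩

theorem exists_to (hkl : k ≤ l) (v : B.V l) : ∃ p : B.Path k l, p.vtx l hkl le_rfl = v := by
  choose g hg using fun i => B.r_surjective i
  let w : ∀ i, i ≤ l → B.V i := fun i hi =>
    Nat.decreasingInduction (motive := fun i _ => B.V i) (fun j _ u => B.s j (g j u)) v hi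
  exact ⟨{ vtx := fun i _ hl => w i hl
           edge := fun i _ hl => g i (w (i + 1) hl)
           src := fun i hk hl =>
            (Nat.decreasingInduction_succ_left (motive := fun i _ => B.V i)
              (fun j _ u => B.s j (g j u)) v hl hl.le).symm
           rng := fun i hk hl => hg i _ }, Nat.decreasingInduction_self _ _⟩

end Path

/-- The contraction of `B` to the levels `m 0 = 0 < m 1 < m 2 < …`: the edges from level `n` to
level `n + 1` are the paths of `B` from level `m n` to level `m (n + 1)`, with the lexicographic
order. -/
def contract (B : OrderedBratteliDiagram) (m : ℕ → ℕ) (hm : StrictMono m) (h0 : m 0 = 0) :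
    OrderedBratteliDiagram where
  V n := B.V (m n)
  E n := B.Path (m n) (m (n + 1))
  V_finite n := B.V_finite (m n)
  E_finite n := Path.finite (hm n.lt_succ_self)
  V_nonempty n := B.V_nonempty (m n)
  root_unique := by rw [h0]; exact B.root_unique
  s n p := p.vtx (m n) le_rfl (hm n.lt_succ_self).le
  r n p := p.vtx (m (n + 1)) (hm n.lt_succ_self).le le_rfl
  s_surjective n := Path.exists_from (hm n.lt_succ_self).le
  r_surjective n := Path.exists_to (hm n.lt_succ_self).le
  ord n := inferInstance
  comparable_iff n p q := Path.comparable (hm n.lt_succ_self) p q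

/-- An isomorphism of ordered Bratteli diagrams: bijections of vertices and edges that preserve
the gradings, intertwine the source and range maps, and preserve the order of the edges. -/
structure Iso (B C : OrderedBratteliDiagram) where
  onV : ∀ n, B.V n ≃ C.V n
  onE : ∀ n, B.E n ≃o C.E n
  map_s : ∀ n (e : B.E n), C.s n (onE n e) = onV n (B.s n e)
  map_r : ∀ n (e : B.E n), C.r n (onE n e) = onV (n + 1) (B.r n e)

/-- Equivalence of ordered Bratteli diagrams: the equivalence relation generated by isomorphism
and contraction. -/
def Equivalent : OrderedBratteliDiagram → OrderedBratteliDiagram → Prop :=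
  Relation.EqvGen fun B C => Nonempty (B.Iso C) ∨
    ∃ (m : ℕ → ℕ) (hm : StrictMono m) (h0 : m 0 = 0), C = B.contract m hm h0

end OrderedBratteliDiagram

/-! ### Partial homeomorphisms -/

section Dynamics

variable {X : Type*} [TopologicalSpace X]

/-- The `n`-fold composition of a partial homeomorphism with itself, on its natural domain. -/
def partialPow (h : OpenPartialHomeomorph X X) : ℕ → OpenPartialHomeomorph X X
  | 0 => OpenPartialHomeomorph.refl X
  | n + 1 => (partialPow h n).trans h

/-- The iterate `h ^ n`, `n ∈ ℤ`, of a partial homeomorphism, on its natural domain. -/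
def partialZPow (h : OpenPartialHomeomorph X X) : ℤ → OpenPartialHomeomorph X X
  | Int.ofNat n => partialPow h n
  | Int.negSucc n => (partialPow h (n + 1)).symm

/-- The orbit of `x`: all points `h ^ n x`, `n ∈ ℤ`, that are defined. -/
def partialOrbit (h : OpenPartialHomeomorph X X) (x : X) : Set X :=
  {y | ∃ n : ℤ, x ∈ (partialZPow h n).source ∧ partialZPow h n x = y}

/-- `h` is minimal: every orbit is dense. -/
def IsMinimalPartial (h : OpenPartialHomeomorph X X) : Prop :=
  ∀ x, Dense (partialOrbit h x)

/-- A Kakutani-Rokhlin partition of `X` for the homeomorphism `h` from `U = h.source` onto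
`h.target`: a partition of `X` into nonempty clopen sets `E k j`, where `k` ranges over the towers
and `0 ≤ j < J k` over the floors of the tower `k`. Floors are counted from `0`, so that `E k 0` is
the base and `E k (J k - 1)` is the top; the value of `E k j` for `j ≥ J k` has no meaning and is
never used. -/
structure KRPartition (h : OpenPartialHomeomorph X X) where
  K : ℕ
  K_pos : 0 < K
  J : Fin K → ℕ
  J_pos : ∀ k, 0 < J k
  E : Fin K → ℕ → Set X
  isClopen : ∀ k j, j < J k → IsClopen (E k j)
  nonempty : ∀ k j, j < J k → (E k j).Nonempty
  disjoint : ∀ k j k' j', j < J k → j' < J k' → (k, j) ≠ (k', j') → Disjoint (E k j) (E k' j')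
  cover : ∀ x, ∃ k j, j < J k ∧ x ∈ E k j
  source_compl_subset : h.sourceᶜ ⊆ ⋃ k, E k (J k - 1)
  target_compl_subset : h.targetᶜ ⊆ ⋃ k, E k 0
  map_floor : ∀ k j, j + 1 < J k → h '' E k j = E k (j + 1)
  map_top : (⋃ k, h '' (E k (J k - 1) \ h.sourceᶜ)) ∪ h.targetᶜ = ⋃ k, E k 0

namespace KRPartition

variable {h : OpenPartialHomeomorph X X}

/-- The union of the bases of the towers. -/
def base (P : KRPartition h) : Set X := ⋃ k, P.E k 0

/-- The members of the partition. -/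
def members (P : KRPartition h) : Set (Set X) := {A | ∃ k j, j < P.J k ∧ A = P.E k j}

/-- `P` is finer than `Q`. -/
def Finer (P Q : KRPartition h) : Prop := ∀ A ∈ P.members, ∃ B ∈ Q.members, A ⊆ B

theorem eq_of_mem (P : KRPartition h) {k j k' j'} (hj : j < P.J k) (hj' : j' < P.J k') {x : X}
    (hx : x ∈ P.E k j) (hx' : x ∈ P.E k' j') : k = k' ∧ j = j' := by
  by_contra hne
  refine Set.disjoint_left.1 (P.disjoint k j k' j' hj hj' fun he => hne ?_) hx hx'
  exact Prod.mk.inj he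

/-- Every floor other than a top lies in the domain of `h`. -/
theorem subset_source (P : KRPartition h) {k j} (hj : j + 1 < P.J k) :
    P.E k j ⊆ h.source := by
  intro x hx
  by_contra hxs
  obtain ⟨k', hk'⟩ := Set.mem_iUnion.1 (P.source_compl_subset hxs)
  obtain ⟨rfl, h2⟩ := P.eq_of_mem (by omega) (by have := P.J_pos k'; omega) hx hk'
  omega

/-- The partition `{X}`, with one tower of height one. -/
def trivial (h : OpenPartialHomeomorph X X) [Nonempty X] : KRPartition h where
  K := 1
  K_pos := one_pos
  J _ := 1
  J_pos _ := one_pos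
  E _ _ := Set.univ
  isClopen _ _ _ := isClopen_univ
  nonempty _ _ _ := Set.univ_nonempty
  disjoint k j k' j' hj hj' hne := by
    refine absurd ?_ hne
    rw [Subsingleton.elim k k', Nat.lt_one_iff.1 hj, Nat.lt_one_iff.1 hj']
  cover x := ⟨0, 0, one_pos, Set.mem_univ x⟩
  source_compl_subset x _ := Set.mem_iUnion.2 ⟨0, Set.mem_univ x⟩
  target_compl_subset x _ := Set.mem_iUnion.2 ⟨0, Set.mem_univ x⟩
  map_floor k j hj := by omega
  map_top := by
    have : (Set.univ \ h.sourceᶜ : Set X) = h.source := by simp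
    rw [this, Set.iUnion_const, Set.iUnion_const, h.image_source_eq_target, Set.union_compl_self]

/-- The tower `k` of `P` passes through the tower `m` of `Q` from the floor `j` on. -/
def Passes (P Q : KRPartition h) (k : Fin P.K) (m : Fin Q.K) (j : ℕ) : Prop :=
  j + Q.J m ≤ P.J k ∧ ∀ i, i < Q.J m → P.E k (j + i) ⊆ Q.E m i

theorem passes_of_subset {P Q : KRPartition h} (hb : P.base ⊆ Q.base) {k m j}
    (hj : j < P.J k) (hs : P.E k j ⊆ Q.E m 0) : P.Passes Q k m j := by
  have key : ∀ i, i < Q.J m → j + i < P.J k ∧ P.E k (j + i) ⊆ Q.E m i := by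
    intro i
    induction i with
    | zero => exact fun _ => ⟨hj, hs⟩
    | succ i ih =>
      intro hi
      obtain ⟨h1, h2⟩ := ih (by omega)
      have hlt : j + i + 1 < P.J k := by
        by_contra hcon
        have htop : j + i = P.J k - 1 := by omega
        obtain ⟨x, hx⟩ := P.nonempty k _ h1
        have hxs : x ∈ h.source := Q.subset_source hi (h2 hx)
        have hmem : h x ∈ P.base := by
          rw [base, ← P.map_top]
          refine Or.inl (Set.mem_iUnion.2 ⟨k, x, ⟨htop ▸ hx, ?_⟩, rfl⟩)
          simpa using hxs
        obtain ⟨m', hm'⟩ := Set.mem_iUnion.1 (hb hmem)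
        have hmem' : h x ∈ Q.E m (i + 1) := by
          rw [← Q.map_floor m i hi]
          exact ⟨x, h2 hx, rfl⟩
        have := (Q.eq_of_mem (Q.J_pos m') hi hm' hmem').2
        omega
      refine ⟨hlt, ?_⟩
      rw [← add_assoc, ← P.map_floor k _ hlt, ← Q.map_floor m i hi]
      exact Set.image_mono h2
  refine ⟨?_, fun i hi => (key i hi).2⟩
  have := (key (Q.J m - 1) (by have := Q.J_pos m; omega)).1
  have := Q.J_pos m
  omega

theorem Passes.lt {P Q : KRPartition h} {k m j} (hp : P.Passes Q k m j) : j < P.J k := by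
  have := hp.1
  have := Q.J_pos m
  omega

theorem Passes.unique {P Q : KRPartition h} {k m m' j} (hp : P.Passes Q k m j)
    (hp' : P.Passes Q k m' j) : m = m' := by
  obtain ⟨x, hx⟩ := P.nonempty k j hp.lt
  exact (Q.eq_of_mem (Q.J_pos m) (Q.J_pos m') (hp.2 0 (Q.J_pos m) hx)
    (hp'.2 0 (Q.J_pos m') hx)).1

theorem exists_passes_range {P Q : KRPartition h} (hb : P.base ⊆ Q.base) (hf : P.Finer Q)
    (k : Fin P.K) : ∃ m j, P.Passes Q k m j := by
  obtain ⟨B, ⟨m, i, hi, rfl⟩, hs⟩ := hf _ ⟨k, 0, P.J_pos k, rfl⟩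
  obtain ⟨x, hx⟩ := P.nonempty k 0 (P.J_pos k)
  obtain ⟨m', hm'⟩ := Set.mem_iUnion.1 (hb (Set.mem_iUnion.2 ⟨k, hx⟩))
  obtain ⟨rfl, rfl⟩ := Q.eq_of_mem hi (Q.J_pos m') (hs hx) hm'
  exact ⟨m, 0, passes_of_subset hb (P.J_pos k) hs⟩

theorem exists_passes_source {P Q : KRPartition h} (hb : P.base ⊆ Q.base) (hf : P.Finer Q)
    (m : Fin Q.K) : ∃ k j, P.Passes Q k m j := by
  obtain ⟨x, hx⟩ := Q.nonempty m 0 (Q.J_pos m)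
  obtain ⟨k, j, hj, hxP⟩ := P.cover x
  obtain ⟨B, ⟨m', i, hi, rfl⟩, hs⟩ := hf _ ⟨k, j, hj, rfl⟩
  obtain ⟨rfl, rfl⟩ := Q.eq_of_mem hi (Q.J_pos m) (hs hxP) hx
  exact ⟨k, j, passes_of_subset hb hj hs⟩

/-- The edges from the towers of `Q` to the towers of `P`: one for each time that a tower
`range` of `P` passes through a tower `source` of `Q`. -/
@[ext]
structure Edge (P Q : KRPartition h) where
  source : Fin Q.K
  range : Fin P.K
  offset : ℕ
  passes : P.Passes Q range source offset

theorem Edge.ext_of {P Q : KRPartition h} {e f : P.Edge Q} (hr : e.range = f.range)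
    (ho : e.offset = f.offset) : e = f := by
  obtain ⟨m, k, j, hp⟩ := e
  obtain ⟨m', k', j', hp'⟩ := f
  obtain rfl : k = k' := hr
  obtain rfl : j = j' := ho
  obtain rfl := hp.unique hp'
  rfl

/-- Edges with the same range are ordered by their offset. -/
instance (P Q : KRPartition h) : PartialOrder (P.Edge Q) where
  le e f := e.range = f.range ∧ e.offset ≤ f.offset
  le_refl e := ⟨rfl, le_rfl⟩
  le_trans _ _ _ h1 h2 := ⟨h1.1.trans h2.1, h1.2.trans h2.2⟩
  le_antisymm _ _ h1 h2 := Edge.ext_of h1.1 (le_antisymm h1.2 h2.2)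

theorem Edge.finite (P Q : KRPartition h) : Finite (P.Edge Q) := by
  let f : P.Edge Q → Σ k : Fin P.K, Fin (P.J k) := fun e => ⟨e.range, e.offset, e.passes.lt⟩
  refine Finite.of_injective f fun e e' hee => ?_
  obtain ⟨m, k, j, hp⟩ := e
  obtain ⟨m', k', j', hp'⟩ := e'
  simp only [f, Sigma.mk.injEq] at hee
  obtain ⟨rfl, hee⟩ := hee
  exact Edge.ext_of rfl (congrArg Fin.val (eq_of_heq hee))

end KRPartition

/-- A sequence of Kakutani-Rokhlin partitions, each finer than the one before, whose bases
decrease to the complement of `h.target`, and whose members generate the topology. -/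
structure KRSequence (h : OpenPartialHomeomorph X X) where
  part : ℕ → KRPartition h
  base_antitone : ∀ n, (part (n + 1)).base ⊆ (part n).base
  iInter_base : ⋂ n, (part n).base = h.targetᶜ
  finer : ∀ n, (part (n + 1)).Finer (part n)
  generates : ‹TopologicalSpace X› =
    TopologicalSpace.generateFrom (⋃ n, (part n).members)

namespace KRSequence

variable {h : OpenPartialHomeomorph X X}

theorem nonempty_space (S : KRSequence h) : Nonempty X :=
  let P := S.part 0
  ((P.nonempty ⟨0, P.K_pos⟩ 0 (P.J_pos _)).nonempty)

/-- The partitions that define the levels of the diagram: the partition `{X}` at level `0` and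
the `n`-th partition of the sequence at every level `n ≥ 1`. -/
def level (S : KRSequence h) : ℕ → KRPartition h
  | 0 => haveI := S.nonempty_space; KRPartition.trivial h
  | n + 1 => S.part (n + 1)

theorem level_base (S : KRSequence h) (n : ℕ) : (S.level (n + 1)).base ⊆ (S.level n).base := by
  cases n with
  | zero => exact fun x _ => Set.mem_iUnion.2 ⟨(0 : Fin 1), Set.mem_univ x⟩
  | succ n => exact S.base_antitone (n + 1)

theorem level_finer (S : KRSequence h) (n : ℕ) : (S.level (n + 1)).Finer (S.level n) := by
  cases n with
  | zero => exact fun A _ => ⟨Set.univ, ⟨(0 : Fin 1), 0, one_pos, rfl⟩, Set.subset_univ A⟩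
  | succ n => exact S.finer (n + 1)

/-- The ordered Bratteli diagram of a sequence of Kakutani-Rokhlin partitions: the vertices at
level `n` are the towers of the `n`-th partition, and the edges into a tower are its passages
through the towers of the partition before, in the order in which they occur. -/
def diagram (S : KRSequence h) : OrderedBratteliDiagram where
  V n := Fin (S.level n).K
  E n := (S.level (n + 1)).Edge (S.level n)
  V_finite n := inferInstance
  E_finite n := KRPartition.Edge.finite _ _
  V_nonempty n := ⟨⟨0, (S.level n).K_pos⟩⟩
  root_unique v w := Subsingleton.elim (α := Fin 1) v w
  s n e := e.source
  r n e := e.range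
  s_surjective n m := by
    obtain ⟨k, j, hp⟩ := KRPartition.exists_passes_source (S.level_base n) (S.level_finer n) m
    exact ⟨⟨m, k, j, hp⟩, rfl⟩
  r_surjective n k := by
    obtain ⟨m, j, hp⟩ := KRPartition.exists_passes_range (S.level_base n) (S.level_finer n) k
    exact ⟨⟨m, k, j, hp⟩, rfl⟩
  ord n := inferInstance
  comparable_iff n e f := by
    constructor
    · rintro (h1 | h1)
      · exact h1.1
      · exact h1.1.symm
    · intro h1
      rcases le_total e.offset f.offset with h2 | h2
      · exact Or.inl ⟨h1, h2⟩
      · exact Or.inr ⟨h1.symm, h2⟩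

end KRSequence

end Dynamics

/-! An edge of the diagram records one passage of a fine tower through a coarse tower, starting at a
given offset. Passages compose, and their offsets add (`Passes.trans`). Conversely, a point in the
first floor of a passage has a tower and a floor at every intermediate level, and these spell out a
path. Thus paths between two levels are exactly the passages between the two partitions. Distinct
passages of one tower do not overlap, so the lexicographic order of paths is the order of total
offsets (`pathOrderIso`). Hence contracting a diagram amounts to passing to a subsequence of
partitions (`equivalent_comp`).

Compactness makes the two sequences mutually cofinal for refinement (`exists_level_refines`). One
can therefore interleave them into a single chain, whose even levels form a subsequence of one
sequence and whose odd levels, after the common root, form a subsequence of the other. Both diagrams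
then share contractions, up to isomorphism, with the diagram of that chain. -/

open OrderedBratteliDiagram

/-! ### Passages between partitions: composition, location, disjointness -/

namespace KRPartition

variable {X : Type*} [TopologicalSpace X] {h : OpenPartialHomeomorph X X}

theorem floor_mem_base {P : KRPartition h} (k : Fin P.K) : P.E k 0 ⊆ P.base :=
  Set.subset_iUnion (fun k => P.E k 0) k

theorem eq_zero_of_mem_base {P : KRPartition h} {k j} (hj : j < P.J k) {x : X}
    (hx : x ∈ P.E k j) (hb : x ∈ P.base) : j = 0 := by
  obtain ⟨m, hm⟩ := Set.mem_iUnion.1 hb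
  exact (P.eq_of_mem hj (P.J_pos m) hx hm).2

theorem Finer.refl (P : KRPartition h) : P.Finer P := fun A hA => ⟨A, hA, subset_rfl⟩

theorem Finer.trans {P Q R : KRPartition h} (h1 : P.Finer Q) (h2 : Q.Finer R) : P.Finer R := by
  intro A hA
  obtain ⟨B, hB, hAB⟩ := h1 A hA
  obtain ⟨C, hC, hBC⟩ := h2 B hB
  exact ⟨C, hC, hAB.trans hBC⟩

theorem Passes.refl (P : KRPartition h) (k : Fin P.K) : P.Passes P k k 0 :=
  ⟨by omega, fun i _ => by rw [zero_add]⟩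

theorem Passes.trans {P Q R : KRPartition h} {k m r j j'} (h1 : P.Passes Q k m j)
    (h2 : Q.Passes R m r j') : P.Passes R k r (j + j') := by
  have hj := h1.1
  have hj' := h2.1
  refine ⟨by omega, fun i hi => ?_⟩
  rw [add_assoc]
  exact (h1.2 _ (by omega)).trans (h2.2 i hi)

/-- If a floor of `P` lies in the `i`-th floor of a tower of `Q`, then `P` passes through that
whole tower, starting `i` floors below. -/
theorem passes_of_subset_floor {P Q : KRPartition h} (hb : P.base ⊆ Q.base) {k m} :
    ∀ {i j}, i < Q.J m → j < P.J k → P.E k j ⊆ Q.E m i → i ≤ j ∧ P.Passes Q k m (j - i) := by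
  intro i
  induction i with
  | zero => exact fun _ hj hs => ⟨Nat.zero_le _, passes_of_subset hb hj hs⟩
  | succ i ih =>
    intro j hi hj hs
    -- A bottom floor of `P` lies in the base of `Q`, so it cannot lie at a positive height.
    obtain _ | j := j
    · obtain ⟨x, hx⟩ := P.nonempty k 0 hj
      exact absurd (eq_zero_of_mem_base hi (hs hx) (hb (floor_mem_base k hx))) (by omega)
    · have hs' : P.E k j ⊆ Q.E m i := by
        intro x hx
        have hx' : h x ∈ Q.E m (i + 1) := hs (P.map_floor k j hj ▸ ⟨x, hx, rfl⟩)
        rw [← Q.map_floor m i hi] at hx'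
        obtain ⟨y, hy, hyx⟩ := hx'
        -- Injectivity of `h` on its domain allows descending by one floor in both towers at once.
        exact h.injOn (Q.subset_source hi hy) (P.subset_source hj hx) hyx ▸ hy
      obtain ⟨h1, h2⟩ := ih (by omega) (by omega) hs'
      exact ⟨by omega, by rwa [Nat.add_sub_add_right]⟩

/-- The floor of `P` at a point lies in the floor of a coarser partition at that point. -/
theorem Finer.subset_of_mem {P Q : KRPartition h} (hf : P.Finer Q) {k j m i}
    (hj : j < P.J k) (hi : i < Q.J m) {x : X} (hx : x ∈ P.E k j) (hx' : x ∈ Q.E m i) :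
    P.E k j ⊆ Q.E m i := by
  obtain ⟨B, ⟨m', i', hi', rfl⟩, hs⟩ := hf _ ⟨k, j, hj, rfl⟩
  obtain ⟨rfl, rfl⟩ := Q.eq_of_mem hi' hi (hs hx) hx'
  exact hs

/-- Distinct passages of a tower of `P` do not overlap. -/
theorem Passes.add_le {P Q : KRPartition h} {k m m' j j'}
    (h1 : P.Passes Q k m j) (h2 : P.Passes Q k m' j') (hlt : j < j') : j + Q.J m ≤ j' := by
  by_contra hcon
  -- In case of overlap, such a point would have height `j' - j > 0` in `Q` by the first passage and
  -- height `0` by the second.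
  obtain ⟨x, hx⟩ := P.nonempty k j' h2.lt
  have hx1 := h1.2 (j' - j) (by omega)
  rw [Nat.add_sub_of_le hlt.le] at hx1
  have := (Q.eq_of_mem (by omega) (Q.J_pos m') (hx1 hx) (h2.2 0 (Q.J_pos m') hx)).2
  omega

theorem isOpen_base (P : KRPartition h) : IsOpen P.base :=
  isOpen_iUnion fun k => (P.isClopen k 0 (P.J_pos k)).isOpen

theorem isClosed_base (P : KRPartition h) : IsClosed P.base :=
  isClosed_iUnion_of_finite fun k => (P.isClopen k 0 (P.J_pos k)).isClosed

/-- `P` refines `Q` as a Kakutani-Rokhlin partition: it is finer and has a smaller base. -/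
def Refines (P Q : KRPartition h) : Prop := P.base ⊆ Q.base ∧ P.Finer Q

theorem Refines.refl (P : KRPartition h) : P.Refines P := ⟨subset_rfl, Finer.refl P⟩

theorem Refines.trans {P Q R : KRPartition h} (h1 : P.Refines Q) (h2 : Q.Refines R) :
    P.Refines R := ⟨h1.1.trans h2.1, h1.2.trans h2.2⟩

end KRPartition

/-! ### Chains of partitions: contraction is passage to a subsequence -/

/-- A sequence of Kakutani-Rokhlin partitions, each refining the one before, that starts with a
single tower. -/
@[ext]
structure KRChain {X : Type*} [TopologicalSpace X] (h : OpenPartialHomeomorph X X) where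
  part : ℕ → KRPartition h
  root : Subsingleton (Fin (part 0).K)
  refines_succ : ∀ n, (part (n + 1)).Refines (part n)

namespace KRChain

variable {X : Type*} [TopologicalSpace X] {h : OpenPartialHomeomorph X X}

theorem refines (S : KRChain h) {k l : ℕ} (hkl : k ≤ l) : (S.part l).Refines (S.part k) := by
  induction l, hkl using Nat.le_induction with
  | base => exact KRPartition.Refines.refl _
  | succ l _ ih => exact (S.refines_succ l).trans ih

/-- The ordered Bratteli diagram of a chain of Kakutani-Rokhlin partitions. -/
def diagram (S : KRChain h) : OrderedBratteliDiagram where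
  V n := Fin (S.part n).K
  E n := (S.part (n + 1)).Edge (S.part n)
  V_finite n := inferInstance
  E_finite n := KRPartition.Edge.finite _ _
  V_nonempty n := ⟨⟨0, (S.part n).K_pos⟩⟩
  root_unique v w := S.root.elim v w
  s n e := e.source
  r n e := e.range
  s_surjective n m := by
    obtain ⟨k, j, hp⟩ :=
      KRPartition.exists_passes_source (S.refines_succ n).1 (S.refines_succ n).2 m
    exact ⟨⟨m, k, j, hp⟩, rfl⟩
  r_surjective n k := by
    obtain ⟨m, j, hp⟩ :=
      KRPartition.exists_passes_range (S.refines_succ n).1 (S.refines_succ n).2 k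
    exact ⟨⟨m, k, j, hp⟩, rfl⟩
  ord n := inferInstance
  comparable_iff n e f := by
    constructor
    · rintro (h1 | h1)
      · exact h1.1
      · exact h1.1.symm
    · intro h1
      rcases le_total e.offset f.offset with h2 | h2
      · exact Or.inl ⟨h1, h2⟩
      · exact Or.inr ⟨h1.symm, h2⟩

/-- The subsequence of a chain along `m`. -/
def comp (S : KRChain h) (m : ℕ → ℕ) (hm : StrictMono m) (h0 : m 0 = 0) : KRChain h where
  part n := S.part (m n)
  root := by rw [h0]; exact S.root
  refines_succ n := S.refines (hm n.lt_succ_self).le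

variable {S : KRChain h} {k l : ℕ}

/-- The offset of the edge of a path at level `i`, and `0` outside the range of the path. -/
def edgeOffset (p : S.diagram.Path k l) (i : ℕ) : ℕ :=
  -- A total function, so that offsets can be summed over `Finset.Ico` without carrying bounds.
  if hi : k ≤ i ∧ i < l then KRPartition.Edge.offset (p.edge i hi.1 hi.2) else 0

theorem edgeOffset_eq (p : S.diagram.Path k l) {i : ℕ} (hk : k ≤ i) (hl : i < l) :
    edgeOffset p i = KRPartition.Edge.offset (p.edge i hk hl) := dif_pos ⟨hk, hl⟩

theorem passes_edge (p : S.diagram.Path k l) {i : ℕ} (hk : k ≤ i) (hl : i < l) :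
    (S.part (i + 1)).Passes (S.part i) (p.vtx (i + 1) (by omega) hl) (p.vtx i hk hl.le)
      (edgeOffset p i) := by
  rw [edgeOffset_eq p hk hl, ← p.src i hk hl, ← p.rng i hk hl]
  exact KRPartition.Edge.passes (p.edge i hk hl)

theorem passes_path (p : S.diagram.Path k l) {i : ℕ} (hk : k ≤ i) (hl : i ≤ l) :
    (S.part i).Passes (S.part k) (p.vtx i hk hl) (p.vtx k le_rfl (hk.trans hl))
      (∑ j ∈ Finset.Ico k i, edgeOffset p j) := by
  induction i, hk using Nat.le_induction with
  | base =>
    rw [Finset.Ico_self, Finset.sum_empty]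
    exact KRPartition.Passes.refl _ _
  | succ i hk ih =>
    rw [Finset.sum_Ico_succ_top hk, add_comm (Finset.sum _ _)]
    exact (passes_edge p hk hl).trans (ih (by omega))

/-- The passage of a tower at level `l` through a tower at level `k` defined by a path. -/
def pathEdge (hkl : k ≤ l) (p : S.diagram.Path k l) : (S.part l).Edge (S.part k) where
  source := p.vtx k le_rfl hkl
  range := p.vtx l hkl le_rfl
  offset := ∑ j ∈ Finset.Ico k l, edgeOffset p j
  passes := passes_path p hkl le_rfl

/-- Split the offset at the last level where the paths differ. The parts above agree. At that level
the offsets differ by at least the height of the tower through which `p` passes, and this height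
exceeds the part of the offset of `p` from below. -/
theorem pathEdge_offset_lt (hkl : k < l) {p q : S.diagram.Path k l} (hpq : p.Lt q) :
    (pathEdge hkl.le p).offset < (pathEdge hkl.le q).offset := by
  obtain ⟨i, hk, hl, hlt, hagree⟩ := hpq
  have hr : KRPartition.Edge.range (p.edge i hk hl) = KRPartition.Edge.range (q.edge i hk hl) :=
    (S.diagram.comparable_iff i _ _).1 (Or.inl hlt.le)
  have hoff : KRPartition.Edge.offset (p.edge i hk hl)
      < KRPartition.Edge.offset (q.edge i hk hl) :=
    lt_of_le_of_ne hlt.le.2 fun ho => hlt.ne (KRPartition.Edge.ext_of hr ho)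
  have hp := KRPartition.Edge.passes (p.edge i hk hl)
  rw [hr] at hp
  have hadd := hp.add_le (KRPartition.Edge.passes (q.edge i hk hl)) hoff
  have hlow := (passes_path p hk hl.le).lt
  rw [← p.src i hk hl] at hlow
  have hlow' : ∑ j ∈ Finset.Ico k i, edgeOffset p j
      < (S.part i).J (KRPartition.Edge.source (p.edge i hk hl)) := hlow
  have htail : ∑ j ∈ Finset.Ico (i + 1) l, edgeOffset p j
      = ∑ j ∈ Finset.Ico (i + 1) l, edgeOffset q j := by
    refine Finset.sum_congr rfl fun j hj => ?_
    obtain ⟨hj1, hj2⟩ := Finset.mem_Ico.1 hj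
    rw [edgeOffset_eq p (by omega) hj2, edgeOffset_eq q (by omega) hj2,
      hagree j (by omega) hj2]
  have hsplit : ∀ t : S.diagram.Path k l, (pathEdge hkl.le t).offset
      = ∑ j ∈ Finset.Ico k i, edgeOffset t j + KRPartition.Edge.offset (t.edge i hk hl)
        + ∑ j ∈ Finset.Ico (i + 1) l, edgeOffset t j := by
    intro t
    rw [← edgeOffset_eq t hk hl, ← Finset.sum_Ico_succ_top hk,
      Finset.sum_Ico_consecutive _ (by omega) (by omega)]
    rfl
  rw [hsplit p, hsplit q, htail]
  omega

/-- Paths with the same range are comparable, so strict monotonicity of the offset also reflects the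
order; injectivity of `pathEdge` follows. -/
theorem pathEdge_le_iff (hkl : k < l) (p q : S.diagram.Path k l) :
    pathEdge hkl.le p ≤ pathEdge hkl.le q ↔ p ≤ q := by
  constructor
  · intro hle
    rcases (Path.comparable hkl p q).2 hle.1 with hpq | rfl | hqp
    · exact hpq
    · exact le_rfl
    · exact absurd hle.2 (pathEdge_offset_lt hkl hqp).not_ge
  · rintro (rfl | hpq)
    · exact le_rfl
    · exact ⟨hpq.range_eq hkl, (pathEdge_offset_lt hkl hpq).le⟩

theorem pathEdge_surjective (hkl : k ≤ l) :
    Function.Surjective (pathEdge (S := S) hkl) := by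
  intro e
  obtain ⟨x, hx⟩ := (S.part l).nonempty e.range e.offset e.passes.lt
  -- The tower and floor of `x` at every level: the towers are the vertices of the path, the
  -- differences of heights its offsets.
  choose v j hj hxv using fun i => (S.part i).cover x
  have key : ∀ i, j i ≤ j (i + 1) ∧
      (S.part (i + 1)).Passes (S.part i) (v (i + 1)) (v i) (j (i + 1) - j i) := fun i =>
    KRPartition.passes_of_subset_floor (S.refines_succ i).1 (hj i) (hj (i + 1))
      ((S.refines_succ i).2.subset_of_mem (hj (i + 1)) (hj i) (hxv (i + 1)) (hxv i))
  let p : S.diagram.Path k l :=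
    { vtx := fun i _ _ => v i
      edge := fun i _ _ => (⟨v i, v (i + 1), j (i + 1) - j i, (key i).2⟩ :
        (S.part (i + 1)).Edge (S.part i))
      src := fun _ _ _ => rfl
      rng := fun _ _ _ => rfl }
  -- The offsets telescope. Below, `j k = 0` because `x` lies in the first floor of the passage.
  have hsum : ∀ i, k ≤ i → i ≤ l → ∑ t ∈ Finset.Ico k i, edgeOffset p t + j k = j i := by
    intro i hk
    induction i, hk using Nat.le_induction with
    | base => simp
    | succ i hk ih =>
      intro hl
      have h1 := ih (by omega)
      have h2 : edgeOffset p i = j (i + 1) - j i := edgeOffset_eq p hk hl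
      have h3 := (key i).1
      rw [Finset.sum_Ico_succ_top hk, h2]
      omega
  obtain ⟨hv, ho⟩ := (S.part l).eq_of_mem (hj l) e.passes.lt (hxv l) hx
  have hx0 := e.passes.2 0 ((S.part k).J_pos _) hx
  have h0 := ((S.part k).eq_of_mem (hj k) ((S.part k).J_pos _) (hxv k) hx0).2
  refine ⟨p, KRPartition.Edge.ext_of hv ?_⟩
  have := hsum l hkl le_rfl
  rw [h0, ho] at this
  exact this

/-- Paths between two levels correspond to passages between the two partitions, in order. -/
noncomputable def pathOrderIso (S : KRChain h) {k l : ℕ} (hkl : k < l) :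
    S.diagram.Path k l ≃o (S.part l).Edge (S.part k) :=
  RelIso.ofSurjective (OrderEmbedding.ofMapLEIff _ (pathEdge_le_iff hkl))
    (pathEdge_surjective hkl.le)

/-- The contraction of the diagram of a chain is the diagram of the subsequence. -/
noncomputable def contractIso (S : KRChain h) (m : ℕ → ℕ) (hm : StrictMono m) (h0 : m 0 = 0) :
    (S.diagram.contract m hm h0).Iso (S.comp m hm h0).diagram where
  onV _ := Equiv.refl _
  onE n := S.pathOrderIso (hm n.lt_succ_self)
  map_s _ _ := rfl
  map_r _ _ := rfl

theorem equivalent_comp (S : KRChain h) (m : ℕ → ℕ) (hm : StrictMono m) (h0 : m 0 = 0) :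
    S.diagram.Equivalent (S.comp m hm h0).diagram :=
  .trans _ _ _ (.rel _ _ (.inr ⟨m, hm, h0, rfl⟩)) (.rel _ _ (.inl ⟨S.contractIso m hm h0⟩))

end KRChain

/-! ### Cofinality by compactness, and interleaving -/

namespace KRSequence

variable {X : Type*} [TopologicalSpace X] {h : OpenPartialHomeomorph X X}

/-- The chain of the partitions that define the levels of the diagram. -/
def chain (S : KRSequence h) : KRChain h where
  part := S.level
  root := inferInstanceAs (Subsingleton (Fin 1))
  refines_succ n := ⟨S.level_base n, S.level_finer n⟩

theorem base_mono (S : KRSequence h) {m n : ℕ} (hmn : m ≤ n) :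
    (S.part n).base ⊆ (S.part m).base :=
  antitone_nat_of_succ_le (f := fun n => (S.part n).base) S.base_antitone hmn

theorem finer_of_le (S : KRSequence h) {m n : ℕ} (hmn : m ≤ n) :
    (S.part n).Finer (S.part m) := by
  induction n, hmn using Nat.le_induction with
  | base => exact KRPartition.Finer.refl _
  | succ n _ ih => exact (S.finer n).trans ih

/-- Every point of an open set has a member of one of the partitions around it inside the set. -/
theorem exists_member_subset (S : KRSequence h) {U : Set X} (hU : IsOpen U) :
    ∀ x ∈ U, ∃ n, ∀ B ∈ (S.part n).members, x ∈ B → B ⊆ U := by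
  -- Persistence at later stages, so that two stages can be replaced by their maximum for
  -- intersections.
  have hmono : ∀ {x : X} {W : Set X} {m n : ℕ}, m ≤ n →
      (∀ B ∈ (S.part m).members, x ∈ B → B ⊆ W) →
      ∀ B ∈ (S.part n).members, x ∈ B → B ⊆ W := by
    intro x W m n hmn hm B hB hx
    obtain ⟨C, hC, hBC⟩ := S.finer_of_le hmn B hB
    exact hBC.trans (hm C hC (hBC hx))
  have hU' : TopologicalSpace.GenerateOpen (⋃ n, (S.part n).members) U := by
    rw [S.generates] at hU
    exact hU
  clear hU
  induction hU' with
  | basic U hU =>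
    intro x hx
    obtain ⟨n, k, j, hj, rfl⟩ := Set.mem_iUnion.1 hU
    refine ⟨n, ?_⟩
    rintro _ ⟨k', j', hj', rfl⟩ hx'
    obtain ⟨rfl, rfl⟩ := (S.part n).eq_of_mem hj hj' hx hx'
    exact subset_rfl
  | univ => exact fun x _ => ⟨0, fun B _ _ => Set.subset_univ B⟩
  | inter U V _ _ ihU ihV =>
    rintro x ⟨hxU, hxV⟩
    obtain ⟨m, hm⟩ := ihU x hxU
    obtain ⟨n, hn⟩ := ihV x hxV
    exact ⟨max m n, fun B hB hx => Set.subset_inter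
      (hmono (le_max_left m n) hm B hB hx) (hmono (le_max_right m n) hn B hB hx)⟩
  | sUnion T _ ih =>
    rintro x ⟨U, hU, hx⟩
    obtain ⟨n, hn⟩ := ih U hU x hx
    exact ⟨n, fun B hB hxB => (hn B hB hxB).trans (Set.subset_sUnion_of_mem hU)⟩

/-- The bases are closed and decrease to `h.targetᶜ`, which lies in the open set `A.base`;
compactness gives the inclusion at a finite stage. -/
theorem exists_base_subset [CompactSpace X] (S : KRSequence h) (A : KRPartition h) :
    ∃ n, (S.part n).base ⊆ A.base := by
  refine exists_subset_nhds_of_compactSpace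
    (directed_of_isDirected_le fun m n hmn => S.base_mono hmn)
    (fun n => (S.part n).isClosed_base) fun x hx => A.isOpen_base.mem_nhds ?_
  rw [S.iInter_base] at hx
  exact A.target_compl_subset hx

/-- The points whose member at stage `n` fits inside a member of `A` form an open set `G n`. These
sets increase with `n` and cover `X`, so one of them is all of `X`. -/
theorem exists_finer [CompactSpace X] (S : KRSequence h) (A : KRPartition h) :
    ∃ n, (S.part n).Finer A := by
  let G : ℕ → Set X := fun n =>
    ⋃₀ {B | B ∈ (S.part n).members ∧ ∃ C ∈ A.members, B ⊆ C}
  have hopen : ∀ n, IsOpen (G n) := by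
    refine fun n => isOpen_sUnion ?_
    rintro _ ⟨⟨k, j, hj, rfl⟩, -⟩
    exact ((S.part n).isClopen k j hj).isOpen
  have hcover : Set.univ ⊆ ⋃ n, G n := by
    intro x _
    obtain ⟨k, j, hj, hx⟩ := A.cover x
    obtain ⟨n, hn⟩ := S.exists_member_subset (A.isClopen k j hj).isOpen x hx
    obtain ⟨k', j', hj', hx'⟩ := (S.part n).cover x
    exact Set.mem_iUnion.2 ⟨n, _, ⟨⟨k', j', hj', rfl⟩, _, ⟨k, j, hj, rfl⟩,
      hn _ ⟨k', j', hj', rfl⟩ hx'⟩, hx'⟩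
  have hmono : Monotone G := by
    rintro m n hmn x ⟨B, ⟨hB, C, hC, hBC⟩, hx⟩
    obtain ⟨k, j, hj, hx'⟩ := (S.part n).cover x
    obtain ⟨k', j', hj', rfl⟩ := hB
    exact ⟨_, ⟨⟨k, j, hj, rfl⟩, C, hC,
      ((S.finer_of_le hmn).subset_of_mem hj hj' hx' hx).trans hBC⟩, hx'⟩
  obtain ⟨n, hn⟩ := isCompact_univ.elim_directed_cover G hopen hcover hmono.directed_le
  refine ⟨n, ?_⟩
  rintro _ ⟨k, j, hj, rfl⟩
  obtain ⟨x, hx⟩ := (S.part n).nonempty k j hj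
  obtain ⟨B, ⟨⟨k', j', hj', rfl⟩, hC⟩, hxB⟩ := hn (Set.mem_univ x)
  obtain ⟨rfl, rfl⟩ := (S.part n).eq_of_mem hj hj' hx hxB
  exact hC

/-- The levels of the diagram beyond some level refine any given partition. -/
theorem exists_level_refines [CompactSpace X] (S : KRSequence h) (A : KRPartition h) (a : ℕ) :
    ∃ b, a < b ∧ (S.level b).Refines A := by
  obtain ⟨m, hm⟩ := S.exists_base_subset A
  obtain ⟨n, hn⟩ := S.exists_finer A
  refine ⟨max a (max m n) + 1, by omega, ?_⟩
  change (S.part (max a (max m n) + 1)).Refines A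
  exact ⟨(S.base_mono (by omega)).trans hm, (S.finer_of_le (by omega)).trans hn⟩

/-- A chain whose levels are taken from two sequences alternately. -/
theorem exists_interleaving [CompactSpace X] (P Q : KRSequence h) :
    ∃ (R : KRChain h) (a : ℕ → ℕ), StrictMono a ∧ a 0 = 0 ∧
      (∀ n, R.part (2 * n) = Q.level (a (2 * n))) ∧
      ∀ n, R.part (2 * n + 1) = P.level (a (2 * n + 1)) := by
  let S : ℕ → KRSequence h := fun n => if Even n then Q else P
  choose f hf href using fun (n a : ℕ) => (S (n + 1)).exists_level_refines ((S n).level a) a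
  -- Starting at level `0` makes the root the trivial partition, which both sequences share.
  let a : ℕ → ℕ := fun n => Nat.rec 0 f n
  refine ⟨⟨fun n => (S n).level (a n), inferInstanceAs (Subsingleton (Fin 1)),
    fun n => href n (a n)⟩, a, strictMono_nat_of_lt_succ fun n => hf n (a n), rfl,
    fun n => ?_, fun n => ?_⟩
  · have hS : S (2 * n) = Q := if_pos (even_two_mul n)
    change (S (2 * n)).level _ = _
    rw [hS]
  · have hS : S (2 * n + 1) = P := if_neg (Nat.not_even_two_mul_add_one n)
    change (S (2 * n + 1)).level _ = _
    rw [hS]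

/-- A common subsequence gives both diagrams contractions isomorphic to the same diagram. -/
theorem diagram_equivalent_of_subsequence (S : KRSequence h) (R : KRChain h) {a m : ℕ → ℕ}
    (ha : StrictMono a) (ha0 : a 0 = 0) (hm : StrictMono m) (hm0 : m 0 = 0)
    (hR : ∀ n, R.part (m n) = S.level (a n)) : S.diagram.Equivalent R.diagram := by
  have heq : S.chain.comp a ha ha0 = R.comp m hm hm0 := KRChain.ext (funext fun n => (hR n).symm)
  have h1 : S.diagram.Equivalent _ := S.chain.equivalent_comp a ha ha0
  rw [heq] at h1
  exact h1.trans _ _ _ (.symm _ _ (R.equivalent_comp m hm hm0))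

end KRSequence

theorem theorem3p8 {X : Type*} [TopologicalSpace X] (hX : Nonempty (X ≃ₜ (ℕ → Bool)))
    (h : OpenPartialHomeomorph X X)
    (hU_finite : h.sourceᶜ.Finite) (hU_nonempty : h.sourceᶜ.Nonempty)
    (hV_finite : h.targetᶜ.Finite) (hV_nonempty : h.targetᶜ.Nonempty)
    (h_disjoint : Disjoint h.sourceᶜ h.targetᶜ)
    (h_minimal : IsMinimalPartial h)
    (P Q : KRSequence h) :
    P.diagram.Equivalent Q.diagram := by
  obtain ⟨φ⟩ := hX
  have : CompactSpace X := φ.symm.compactSpace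
  obtain ⟨R, a, ha, ha0, hQ, hP⟩ := P.exists_interleaving Q
  -- The levels `0, 1, 3, 5, …`: truncated subtraction sends `0` to the root, which counts as a
  -- level of `P` as well.
  let m : ℕ → ℕ := fun n => 2 * n - 1
  have hm : StrictMono fun n => a (2 * n) := fun i j hij => ha (by omega)
  have h1 : Q.diagram.Equivalent R.diagram :=
    Q.diagram_equivalent_of_subsequence R hm ha0 (m := fun n => 2 * n)
      (fun i j hij => by simpa using hij) rfl hQ
  have hm1 : StrictMono m := by
    refine strictMono_nat_of_lt_succ fun n => ?_
    change 2 * n - 1 < 2 * (n + 1) - 1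
    omega
  have h2 : P.diagram.Equivalent R.diagram := by
    refine P.diagram_equivalent_of_subsequence R (ha.comp hm1) ha0 hm1 rfl fun n => ?_
    cases n with
    | zero =>
      have h0 := hQ 0
      change R.part 0 = Q.level (a 0) at h0
      change R.part 0 = P.level (a 0)
      rw [h0, ha0]
      rfl
    | succ n => exact hP n
  exact h2.trans _ _ _ (.symm _ _ h1)
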